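/- Let $p$ be a prime number, let $\mathbb{F}_p$ be the field with $p$ elements and let $C_p$ be the cyclic group of order $p$. Then the following are equivalent. 1. $p = 2$ or $p = 3$. 2. There is a nonzero finite-dimensional (associative, unital, not necessarily commutative) $\mathbb{F}_p$-algebra whose group of units is an elementary abelian $2$-group, i.e. isomorphic to a direct sum of copies of the cyclic group $C_2$ (the trivial group, the sum of no copies, is included). 3. The Tate cohomology functor $M \mapsto \hat{H}(C_p, M) = (\hat{H}^n(C_p, M))_{n \in \mathbb{Z}}$, with values in $\mathbb{Z}$-graded $\mathbb{F}_p$-vector spaces, is faithful on the stable module category of finitely generated $\mathbb{F}_pC_p$-modules (the category whose objects are the finitely generated $\mathbb{F}_pC_p$-modules and whose morphisms are the $\mathbb{F}_pC_p$-linear maps modulo those that factor through a projective module). -/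

import Mathlib

open CategoryTheory

universe u

/-- A group is an elementary abelian `q`-group if it is isomorphic to a direct sum of copies of the
cyclic group of order `q` (the trivial group is the direct sum of no copies). -/
def IsElementaryAbelian (q : ℕ) (G : Type u) [Group G] : Prop :=
  ∃ ι : Type u, Nonempty (Additive G ≃+ (ι →₀ ZMod q))

namespace StableRep

noncomputable section

section Trace

variable {k G : Type u} [Field k] [Group G]

theorem projective_of_module (M : Rep.{u} k G)
    [h : Module.Projective (MonoidAlgebra k G) M.ρ.asModule] : Projective M := by
  rw [← Rep.equivalenceModuleMonoidAlgebra.map_projective_iff, ← IsProjective.iff_projective]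
  exact h

theorem isZero_groupHomology (M : Rep.{u} k G) [Projective M] (n : ℕ) :
    Limits.IsZero (groupHomology M (n + 1)) := by
  classical
  let adj := Rep.indResAdjunction.{u} k (⊥ : Subgroup G).subtype
  have : (Rep.resFunctor.{u} (k := k) (⊥ : Subgroup G).subtype).Faithful := inferInstance
  have : Epi (adj.counit.app M) := inferInstance
  let s := Projective.factorThru (𝟙 M) (adj.counit.app M)
  have hs : s ≫ adj.counit.app M = 𝟙 M := Projective.factorThru_comp _ _
  have h0 : Limits.IsZero (groupHomology
      (Rep.ind (⊥ : Subgroup G).subtype (Rep.res (⊥ : Subgroup G).subtype M)) (n + 1)) :=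
    (isZero_groupHomology_succ_of_subsingleton
      (Rep.res (⊥ : Subgroup G).subtype M) n).of_iso (groupHomology.indIso _ _ (n + 1))
  let r : Retract M (Rep.ind (⊥ : Subgroup G).subtype (Rep.res (⊥ : Subgroup G).subtype M)) :=
    ⟨s, adj.counit.app M, hs⟩
  have := (r.map (groupHomology.functor k G (n + 1))).splitMono.mono
  exact @Limits.IsZero.of_mono _ _ _ _ _ _ this h0

variable [Fintype G]

/-- The identity of a projective `kG`-module is the trace of a `k`-linear endomorphism. -/
theorem exists_trace_eq_id (M : Rep.{u} k G)
    [Module.Projective (MonoidAlgebra k G) M.ρ.asModule] :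
    ∃ φ : M →ₗ[k] M, ∀ x : M, ∑ g : G, M.ρ g (φ (M.ρ g⁻¹ x)) = x := by
  obtain ⟨s, hs⟩ := (inferInstance : Module.Projective (MonoidAlgebra k G) M.ρ.asModule).out
  let e := M.ρ.asModuleEquiv
  let c : MonoidAlgebra k G →ₗ[k] k :=
    { toFun := fun a => a.coeff 1, map_add' := fun _ _ => rfl, map_smul' := fun _ _ => rfl }
  let ψ : (M.ρ.asModule →₀ MonoidAlgebra k G) →ₗ[k] M.ρ.asModule :=
    Finsupp.lsum k fun p => c.smulRight p
  have hc : ∀ (g : G) (r : k), c (MonoidAlgebra.single g r) = Finsupp.single g r 1 :=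
    fun _ _ => rfl
  have key : ∀ v : M.ρ.asModule →₀ MonoidAlgebra k G,
      ∑ g : G, MonoidAlgebra.of k G g • ψ (MonoidAlgebra.of k G g⁻¹ • v) =
        Finsupp.linearCombination (MonoidAlgebra k G) id v := by
    intro v
    induction v using Finsupp.induction_linear with
    | zero => simp
    | add v w hv hw => simp only [smul_add, map_add, Finset.sum_add_distrib, hv, hw]
    | single p a =>
      induction a using MonoidAlgebra.induction_linear with
      | zero => simp
      | add a b ha hb =>
        simp only [Finsupp.single_add, smul_add, map_add, Finset.sum_add_distrib, ha, hb]
      | single h r =>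
        rw [Finset.sum_eq_single h]
        · simp [ψ, hc, Representation.single_smul]
          rfl
        · intro b _ hb
          have : b⁻¹ * h ≠ 1 := by rwa [Ne, inv_mul_eq_one]
          simp [ψ, hc, this]
        · simp
  refine ⟨e.toLinearMap ∘ₗ ψ ∘ₗ (s.restrictScalars k) ∘ₗ e.symm.toLinearMap, fun x => ?_⟩
  have := key (s (e.symm x))
  rw [hs] at this
  apply e.symm.injective
  rw [← this, map_sum]
  refine Finset.sum_congr rfl fun g _ => ?_
  rw [← map_smul s]
  simp [e, Representation.asModuleEquiv_symm_map_rho]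
  rfl

theorem isZero_groupCohomology (M : Rep.{u} k G) [Projective M] (n : ℕ) :
    Limits.IsZero (groupCohomology M (n + 1)) := by
  classical
  let adj := Rep.coindResAdjunction.{u} k (⊥ : Subgroup G)
  have : (Rep.resFunctor.{u} (k := k) (⊥ : Subgroup G).subtype).Faithful := inferInstance
  have : Epi (adj.counit.app M) := inferInstance
  let s := Projective.factorThru (𝟙 M) (adj.counit.app M)
  have hs : s ≫ adj.counit.app M = 𝟙 M := Projective.factorThru_comp _ _
  have h0 : Limits.IsZero (groupCohomology
      (Rep.coind (⊥ : Subgroup G).subtype (Rep.res (⊥ : Subgroup G).subtype M)) (n + 1)) :=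
    (isZero_groupCohomology_succ_of_subsingleton _ n).of_iso (groupCohomology.coindIso _ _)
  let r : Retract M (Rep.coind (⊥ : Subgroup G).subtype (Rep.res (⊥ : Subgroup G).subtype M)) :=
    ⟨s, adj.counit.app M, hs⟩
  have := (r.map (groupCohomology.functor k G (n + 1))).splitMono.mono
  exact @Limits.IsZero.of_mono _ _ _ _ _ _ this h0

theorem exactAt_zero (M : Rep.{u} k G) (φ : M →ₗ[k] M)
    (hφ : ∀ x : M, ∑ g : G, M.ρ g (φ (M.ρ g⁻¹ x)) = x) : (tateComplex M).ExactAt 0 := by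
  rw [HomologicalComplex.exactAt_iff' _ (-1) 0 1 (by simp) (by simp),
    ShortComplex.moduleCat_exact_iff]
  intro (x : (groupCohomology.inhomogeneousCochains M).X 0)
    (hx : (groupCohomology.inhomogeneousCochains M).d 0 1 x = 0)
  have h1 := ConcreteCategory.congr_hom (groupCohomology.comp_d₀₁_eq M) x
  replace h1 : groupCohomology.d₀₁ M ((groupCohomology.cochainsIso₀ M).hom x) = 0 := by
    refine h1.trans ?_
    rw [ModuleCat.comp_apply, hx, map_zero]
  obtain ⟨y, rfl⟩ : ∃ y, (groupCohomology.cochainsIso₀ M).inv y = x := ⟨_, Iso.hom_inv_id_apply _ x⟩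
  rw [Iso.inv_hom_id_apply] at h1
  have h2 : ∀ g : G, M.ρ g y = y := fun g => sub_eq_zero.1 (congrFun h1 g)
  refine ⟨(groupHomology.chainsIso₀ M).inv (φ y), ?_⟩
  change M.tateNorm _ = (groupCohomology.cochainsIso₀ M).inv y
  rw [Rep.tateNorm, ModuleCat.comp_apply, ModuleCat.comp_apply, Iso.inv_hom_id_apply]
  congr 1
  change (∑ g : G, M.ρ g) (φ y) = y
  rw [LinearMap.sum_apply]
  conv_rhs => rw [← hφ y]
  simp [h2]

theorem exactAt_neg_one (M : Rep.{u} k G) (φ : M →ₗ[k] M)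
    (hφ : ∀ x : M, ∑ g : G, M.ρ g (φ (M.ρ g⁻¹ x)) = x) : (tateComplex M).ExactAt (-1) := by
  rw [HomologicalComplex.exactAt_iff' _ (-2) (-1) 0 (by simp) (by simp),
    ShortComplex.moduleCat_exact_iff]
  intro (x : (groupHomology.inhomogeneousChains M).X 0) (hx : M.tateNorm x = 0)
  obtain ⟨y, rfl⟩ : ∃ y, (groupHomology.chainsIso₀ M).inv y = x := ⟨_, Iso.hom_inv_id_apply _ x⟩
  rw [Rep.tateNorm, ModuleCat.comp_apply, ModuleCat.comp_apply, Iso.inv_hom_id_apply] at hx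
  have h2 : ∑ g : G, M.ρ g y = 0 := by
    have := congrArg (groupCohomology.cochainsIso₀ M).hom hx
    rw [Iso.inv_hom_id_apply, map_zero] at this
    rw [← LinearMap.sum_apply]
    exact this
  have h3 : ∑ g : G, φ (M.ρ g⁻¹ y) = 0 := by
    rw [← map_sum, Fintype.sum_equiv (Equiv.inv G) (fun g => M.ρ g⁻¹ y) (fun g => M.ρ g y)
      (fun _ => rfl), h2, map_zero]
  let c : G →₀ M := ∑ g : G, Finsupp.single g⁻¹ (φ (M.ρ g⁻¹ y))
  have hc : groupHomology.d₁₀ M c = y := by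
    have h4 : ∀ g : G, groupHomology.d₁₀ M (Finsupp.single g⁻¹ (φ (M.ρ g⁻¹ y))) =
        M.ρ g (φ (M.ρ g⁻¹ y)) - φ (M.ρ g⁻¹ y) := fun g => by
      rw [groupHomology.d₁₀_single, inv_inv]
    rw [map_sum, Finset.sum_congr rfl fun g _ => h4 g, Finset.sum_sub_distrib, hφ, h3, sub_zero]
  refine ⟨(groupHomology.chainsIso₁ M).inv c, ?_⟩
  have h4 := ConcreteCategory.congr_hom (groupHomology.eq_d₁₀_comp_inv M) c
  rw [ModuleCat.comp_apply, ModuleCat.comp_apply, hc] at h4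
  exact h4

/-- Tate cohomology vanishes on projective modules, in every degree. -/
theorem isZero_tateCohomology (M : Rep.{u} k G)
    [Module.Projective (MonoidAlgebra k G) M.ρ.asModule] (n : ℤ) :
    Limits.IsZero (tateCohomology M n) := by
  have := projective_of_module M
  obtain ⟨φ, hφ⟩ := exists_trace_eq_id M
  rcases n with (_ | n) | (_ | n)
  · exact (HomologicalComplex.exactAt_iff_isZero_homology _ _).1 (exactAt_zero M φ hφ)
  · exact (isZero_groupCohomology M n).of_iso
      ((TateCohomology.isoGroupCohomology (n + 1)).app M)
  · exact (HomologicalComplex.exactAt_iff_isZero_homology _ _).1 (exactAt_neg_one M φ hφ)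
  · exact (isZero_groupHomology M n).of_iso
      ((TateCohomology.isoGroupHomology (Int.negSucc (n + 1)) (n + 1) (by grind)).app M)

end Trace

variable (k G : Type u) [Field k] [Group G]

/-- The category of finitely generated `kG`-modules, as a full subcategory of the category of
`k`-linear representations of `G`. -/
abbrev FGRep : Type (u + 1) :=
  ObjectProperty.FullSubcategory
    (fun M : Rep.{u} k G => Module.Finite (MonoidAlgebra k G) M.ρ.asModule)

/-- Two maps of finitely generated `kG`-modules are stably equal if their difference factors
through a finitely generated projective `kG`-module. -/
def stableRel : HomRel (FGRep k G) := fun M N f g =>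
  ∃ (P : FGRep k G) (a : M ⟶ P) (b : P ⟶ N),
    Module.Projective (MonoidAlgebra k G) P.obj.ρ.asModule ∧ f - g = a ≫ b

/-- The stable module category of finitely generated `kG`-modules: its objects are the finitely
generated `kG`-modules, its morphisms are `kG`-linear maps modulo those that factor through a
projective module. -/
abbrev StMod : Type (u + 1) := CategoryTheory.Quotient (stableRel k G)

/-- The direct sum of two representations is the direct sum of the corresponding modules. -/
def prodAsModule (M N : Rep.{u} k G) :
    (M.ρ.prod N.ρ).asModule ≃ₗ[MonoidAlgebra k G] M.ρ.asModule × N.ρ.asModule where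
  __ := AddEquiv.refl (M × N)
  map_smul' := by
    intro r (x : M × N)
    change (M.ρ.prod N.ρ).asAlgebraHom r x = (M.ρ.asAlgebraHom r x.1, N.ρ.asAlgebraHom r x.2)
    induction r using MonoidAlgebra.induction_linear with
    | zero => simp only [map_zero, LinearMap.zero_apply]; rfl
    | add a b ha hb => simp only [map_add, LinearMap.add_apply, ha, hb]; rfl
    | single g t => simp [Representation.asAlgebraHom_single]

instance congruence_stableRel : Congruence (stableRel k G) where
  equivalence {M N} :=
    { refl f := by
        let T : Rep.{u} k G := Rep.of (Representation.trivial k G PUnit.{u + 1})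
        have : Subsingleton T.ρ.asModule := inferInstanceAs (Subsingleton PUnit)
        exact ⟨⟨T, inferInstance⟩, 0, 0, inferInstance, by simp⟩
      symm := by
        rintro f g ⟨P, a, b, hP, h⟩
        exact ⟨P, -a, b, hP, by rw [Preadditive.neg_comp, ← h, neg_sub]⟩
      trans := by
        rintro f g h ⟨P, a, b, hP, hab⟩ ⟨Q, c, d, hQ, hcd⟩
        have := P.property
        have := Q.property
        let S : Rep.{u} k G := Rep.of (P.obj.ρ.prod Q.obj.ρ)
        let e := prodAsModule k G P.obj Q.obj
        let i : M.obj ⟶ S := Rep.ofHom ⟨LinearMap.prod a.hom.hom.toLinearMap c.hom.hom.toLinearMap,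
          fun g => by
            ext x
            · exact Rep.hom_comm_apply a.hom g x
            · exact Rep.hom_comm_apply c.hom g x⟩
        let j : S ⟶ N.obj := Rep.ofHom
          ⟨LinearMap.coprod b.hom.hom.toLinearMap d.hom.hom.toLinearMap, fun g => by
            ext x
            · simpa [S] using Rep.hom_comm_apply b.hom g x
            · simpa [S] using Rep.hom_comm_apply d.hom g x⟩
        refine ⟨⟨S, Module.Finite.equiv e.symm⟩, ⟨i⟩, ⟨j⟩, Module.Projective.of_equiv e.symm, ?_⟩
        rw [← sub_add_sub_cancel f g h, hab, hcd]
        rfl }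
  comp_left f g h := by
    rintro ⟨P, a, b, hP, e⟩
    exact ⟨P, f ≫ a, b, hP, by rw [← Preadditive.comp_sub, e, Category.assoc]⟩
  comp_right g := by
    rintro ⟨P, a, b, hP, e⟩
    exact ⟨P, a, b ≫ g, hP, by rw [← Preadditive.sub_comp, e, Category.assoc]⟩

variable [Fintype G]

/-- Tate cohomology `M ↦ Ĥ(G, M) = (Ĥⁿ(G, M))_{n ∈ ℤ}` as a functor to graded `k`-modules. -/
def tate : Rep.{u} k G ⥤ GradedObject ℤ (ModuleCat.{u} k) :=
  tateComplexFunctor k G ⋙ HomologicalComplex.gradedHomologyFunctor _ _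

theorem tate_map_eq (M N : FGRep k G) (f g : M ⟶ N) (h : stableRel k G f g) :
    (ObjectProperty.ι _ ⋙ tate k G).map f = (ObjectProperty.ι _ ⋙ tate k G).map g := by
  obtain ⟨P, a, b, hP, hab⟩ := h
  obtain rfl : f = a ≫ b + g := by rw [← hab]; simp
  funext n
  have h0 := isZero_tateCohomology P.obj n
  change (tateCohomologyFunctor n).map (a.hom ≫ b.hom + g.hom) = (tateCohomologyFunctor n).map g.hom
  have : (tateCohomologyFunctor (R := k) (G := G) n).Additive := by
    unfold tateCohomologyFunctor; infer_instance
  rw [Functor.map_add, Functor.map_comp, h0.eq_of_tgt ((tateCohomologyFunctor n).map a.hom) 0]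
  simp

/-- The Tate cohomology functor `Ĥ(G, -)` on the stable module category. -/
def stableTate : StMod k G ⥤ GradedObject ℤ (ModuleCat.{u} k) :=
  CategoryTheory.Quotient.lift _ (ObjectProperty.ι _ ⋙ tate k G) (tate_map_eq k G)

end

end StableRep

/-! Units: `(ZMod p)ˣ` embeds in `Rˣ` and is cyclic of order `p - 1`, so exponent 2 forces `p - 1 ∣
2`; conversely `R = ZMod p` works.

Faithfulness: with `t = g - 1`, the group algebra is a quotient of `𝔽_p[X]` in which `t ^ p = 0` and
the norm element is `t ^ (p - 1)`. If `f` is zero on Tate cohomology, degree 0 says that `f` sends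
`ker t` into `im t ^ (p - 1)`, and degree -1 that it sends `ker t ^ (p - 1)` into `im t`. For `p ≤
3` no other exponent strictly between 0 and `p` exists, so `exists_factorization_of_nilpotent` makes
`f` stably zero.

For `p > 3`, take `g - 1` on the two-dimensional Jordan block. It is zero on Tate cohomology
(`tateCohomology_map_actSub`). If it factored through a projective it would be a trace `∑ g φ g⁻¹`,
but `trace_jordanRep` shows that traces miss its nonzero entry. -/

/-! ### Factoring maps through free modules -/

open Polynomial in
/-- A map of finitely generated modules over a quotient of `k[X] / (X ^ p)` factors through a free
module as soon as it sends the kernel of `t ^ e` to the image of `t ^ (p - e)` for all `e ≤ p`. -/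
theorem exists_factorization_of_nilpotent {k A M N : Type u} [Field k] [CommRing A] [Algebra k A]
    [AddCommGroup M] [AddCommGroup N] [Module A M] [Module A N] [Module.Finite A M]
    (t : A) (p : ℕ) (ht : t ^ p = 0) (hs : Function.Surjective (aeval (R := k) t))
    (f : M →ₗ[A] N) (h : ∀ e ≤ p, ∀ m : M, t ^ e • m = 0 → ∃ n : N, f m = t ^ (p - e) • n) :
    ∃ (ι : Type u) (_ : Fintype ι) (a : M →ₗ[A] (ι →₀ A)) (b : (ι →₀ A) →ₗ[A] N),
      f = b ∘ₗ a := by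
  classical
  let φ : k[X] →+* A := (aeval (R := k) t).toRingHom
  let : Algebra k[X] A := φ.toAlgebra
  let : Module k[X] M := Module.compHom M φ
  let : Module k[X] N := Module.compHom N φ
  have : IsScalarTower k[X] A M := ⟨fun r a m => by
    rw [Algebra.smul_def, mul_smul]; rfl⟩
  have : IsScalarTower k[X] A N := ⟨fun r a m => by
    rw [Algebra.smul_def, mul_smul]; rfl⟩
  have hφ : ∀ e : ℕ, algebraMap k[X] A (X ^ e) = t ^ e := fun e => by
    change aeval (R := k) t (X ^ e) = t ^ e
    simp
  have hX : ∀ (e : ℕ) (m : M), (X ^ e : k[X]) • m = t ^ e • m := fun e m => by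
    rw [← hφ, algebraMap_smul]
  have : Module.Finite k[X] A := Module.Finite.of_surjective (Algebra.linearMap k[X] A) hs
  have : Module.Finite k[X] M := Module.Finite.trans A M
  have htors : Module.IsTorsion k[X] M := fun {m} =>
    ⟨⟨X ^ p, mem_nonZeroDivisors_of_ne_zero (pow_ne_zero _ X_ne_zero)⟩, by
      change (X ^ p : k[X]) • m = 0
      rw [hX, ht, zero_smul]⟩
  -- Since `X ^ p` kills `M`, each elementary divisor is, up to a unit, a power `X ^ e i` with `e i
  -- ≤ p`.
  obtain ⟨ι, _, q, hq, d, ⟨E⟩⟩ := Module.equiv_directSum_of_isTorsion htors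
  let gen : ι → M := fun i => E.symm (DirectSum.lof k[X] ι
    (fun i => k[X] ⧸ Submodule.span k[X] {q i ^ d i}) i (Submodule.Quotient.mk 1))
  have hdvd : ∀ i, q i ^ d i ∣ X ^ p := fun i => by
    have h1 : (X ^ p : k[X]) • gen i = 0 := by rw [hX, ht, zero_smul]
    rw [← map_smul, ← map_smul, LinearEquiv.map_eq_zero_iff] at h1
    have h2 := DirectSum.of_injective (β := fun i => k[X] ⧸ Submodule.span k[X] {q i ^ d i}) i
      (h1.trans (map_zero (DirectSum.lof k[X] ι _ i)).symm)
    rw [← Submodule.Quotient.mk_smul, Submodule.Quotient.mk_eq_zero,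
      Submodule.mem_span_singleton] at h2
    obtain ⟨c, hc⟩ := h2
    exact ⟨c, by simpa [mul_comm] using hc.symm⟩
  choose e he hass using fun i => (dvd_prime_pow prime_X p).1 (hdvd i)
  have hgen : ∀ i, t ^ e i • gen i = 0 := fun i => by
    rw [← hX, ← map_smul, ← map_smul, ← Submodule.Quotient.mk_smul,
      (Submodule.Quotient.mk_eq_zero _).2, map_zero, map_zero]
    obtain ⟨c, hc⟩ := (hass i).dvd
    rw [Submodule.mem_span_singleton]
    exact ⟨c, by simp [hc, mul_comm]⟩
  choose n hn using fun i => h (e i) (he i) (gen i) (hgen i)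
  -- The `i`-th generator goes to `t ^ (p - e i)` times the `i`-th basis vector, which `t ^ e i`
  -- kills; `b` then sends that basis vector to `n i`.
  let a₀ : (DirectSum ι fun i => k[X] ⧸ Submodule.span k[X] {q i ^ d i}) →ₗ[k[X]] (ι →₀ A) :=
    DirectSum.toModule k[X] ι _ fun i => Submodule.liftQ _
      (LinearMap.toSpanSingleton k[X] _ (Finsupp.single i (t ^ (p - e i)))) (by
        rw [Submodule.span_singleton_le_iff_mem, LinearMap.mem_ker,
          LinearMap.toSpanSingleton_apply, Finsupp.smul_single]
        obtain ⟨c, hc⟩ := (hass i).symm.dvd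
        rw [hc, mul_comm, mul_smul, Algebra.smul_def (X ^ e i), hφ, ← pow_add,
          Nat.add_sub_cancel' (he i), ht, smul_zero, Finsupp.single_zero])
  let a : M →ₗ[A] (ι →₀ A) := (a₀ ∘ₗ E.toLinearMap).extendScalarsOfSurjective hs
  let b : (ι →₀ A) →ₗ[A] N := Finsupp.linearCombination A n
  refine ⟨ι, inferInstance, a, b, ?_⟩
  have key : (f.restrictScalars k[X]) ∘ₗ E.symm.toLinearMap = (b.restrictScalars k[X]) ∘ₗ a₀ := by
    refine DirectSum.linearMap_ext _ fun i => Submodule.linearMap_qext _ (LinearMap.ext_ring ?_)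
    change f (gen i) = b (a₀ (DirectSum.lof k[X] ι _ i (Submodule.Quotient.mk 1)))
    rw [hn, DirectSum.toModule_lof, Submodule.liftQ_apply]
    simp [b]
  ext m
  simpa using! LinearMap.congr_fun key (E m)

/-! ### Zero maps on homology and on Tate cohomology in degrees 0 and -1 -/

/-- Cycles surject onto homology and homology embeds in opcycles, so vanishing can be tested on the
composite from cycles to opcycles. -/
theorem CategoryTheory.ShortComplex.moduleCat_homologyMap_eq_zero_iff {R : Type*} [Ring R]
    {S T : ShortComplex (ModuleCat.{u} R)} (φ : S ⟶ T) :
    ShortComplex.homologyMap φ = 0 ↔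
      ∀ x : S.X₂, S.g x = 0 → ∃ y : T.X₁, T.f y = φ.τ₂ x := by
  have h : ShortComplex.homologyMap φ = 0 ↔ S.iCycles ≫ φ.τ₂ ≫ T.pOpcycles = 0 := by
    rw [← cancel_epi S.homologyπ, ← cancel_mono T.homologyι]
    simp
  rw [h]
  constructor
  · intro h x hx
    have h1 : S.iCycles (S.moduleCatCyclesIso.inv ⟨x, hx⟩) = x :=
      ConcreteCategory.congr_hom S.moduleCatCyclesIso_inv_iCycles ⟨x, hx⟩
    have h2 := ConcreteCategory.congr_hom h (S.moduleCatCyclesIso.inv ⟨x, hx⟩)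
    rw [ModuleCat.comp_apply, ModuleCat.comp_apply, h1] at h2
    exact (T.moduleCat_pOpcycles_eq_zero_iff _).1 h2
  · intro h
    ext z
    rw [ModuleCat.comp_apply, ModuleCat.comp_apply]
    refine (T.moduleCat_pOpcycles_eq_zero_iff _).2 (h _ ?_)
    rw [← ModuleCat.comp_apply, S.iCycles_g]
    rfl

theorem HomologicalComplex.moduleCat_homologyMap_eq_zero_iff {R ι : Type*} [Ring R]
    {c : ComplexShape ι} {K L : HomologicalComplex (ModuleCat.{u} R) c} (φ : K ⟶ L) {i j l : ι}
    (hi : c.prev j = i) (hl : c.next j = l) :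
    HomologicalComplex.homologyMap φ j = 0 ↔
      ∀ x : K.X j, K.d j l x = 0 → ∃ y : L.X i, L.d i j y = φ.f j x := by
  subst hi hl
  exact ShortComplex.moduleCat_homologyMap_eq_zero_iff _

namespace StableRep

variable {k G : Type u} [Field k] [Group G] [Fintype G]

/-- Degree 0 is invariants modulo norms: the norm enters this degree, and the kernel of `d₀₁`
leaving it is the invariants. -/
theorem tateCohomology_zero_map_eq_zero_iff {M N : Rep.{u} k G} (f : M ⟶ N) :
    (tateCohomologyFunctor (R := k) (G := G) 0).map f = 0 ↔
      ∀ x : M, (∀ g, M.ρ g x = x) → ∃ y : N, N.ρ.norm y = f.hom x := by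
  refine (HomologicalComplex.moduleCat_homologyMap_eq_zero_iff (tateComplex.map f)
    (i := -1) (j := 0) (l := 1) (by simp) (by simp)).trans ?_
  have hN : ∀ y : N, N.tateNorm ((groupHomology.chainsIso₀ N).inv y) =
      (groupCohomology.cochainsIso₀ N).inv (N.ρ.norm y) := fun y => by
    rw [Rep.tateNorm, ModuleCat.comp_apply, ModuleCat.comp_apply, Iso.inv_hom_id_apply]
    rfl
  have hf : ∀ x : M, (tateComplex.map f).f 0 ((groupCohomology.cochainsIso₀ M).inv x) =
      (groupCohomology.cochainsIso₀ N).inv (f.hom x) := fun x => rfl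
  have hM : ∀ x : M, (groupCohomology.inhomogeneousCochains M).d 0 1
      ((groupCohomology.cochainsIso₀ M).inv x) = 0 ↔ ∀ g, M.ρ g x = x := fun x => by
    have h := ConcreteCategory.congr_hom (groupCohomology.eq_d₀₁_comp_inv M) x
    rw [ModuleCat.comp_apply, ModuleCat.comp_apply] at h
    rw [h, map_eq_zero_iff _ ((ModuleCat.mono_iff_injective _).1 inferInstance), funext_iff]
    exact forall_congr' fun g => sub_eq_zero
  constructor
  · intro h x hx
    obtain ⟨y, hy⟩ := h ((groupCohomology.cochainsIso₀ M).inv x) ((hM x).2 hx)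
    obtain ⟨y, rfl⟩ : ∃ y', (groupHomology.chainsIso₀ N).inv y' = y :=
      ⟨_, Iso.hom_inv_id_apply _ y⟩
    refine ⟨y, (ModuleCat.mono_iff_injective (groupCohomology.cochainsIso₀ N).inv).1
      inferInstance ?_⟩
    exact (hN y).symm.trans (hy.trans (hf x))
  · intro h x hx
    obtain ⟨x, rfl⟩ : ∃ x', (groupCohomology.cochainsIso₀ M).inv x' = x :=
      ⟨_, Iso.hom_inv_id_apply _ x⟩
    obtain ⟨y, hy⟩ := h x ((hM x).1 hx)
    exact ⟨(groupHomology.chainsIso₀ N).inv y, (hN y).trans ((congrArg _ hy).trans (hf x).symm)⟩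

theorem exists_of_tateCohomology_neg_one_map_eq_zero {M N : Rep.{u} k G} (f : M ⟶ N)
    (h : (tateCohomologyFunctor (R := k) (G := G) (-1)).map f = 0) (x : M)
    (hx : M.ρ.norm x = 0) : ∃ c : G →₀ N, groupHomology.d₁₀ N c = f.hom x := by
  replace h := (HomologicalComplex.moduleCat_homologyMap_eq_zero_iff (tateComplex.map f)
    (i := -2) (j := -1) (l := 0) (by simp) (by simp)).1 h ((groupHomology.chainsIso₀ M).inv x) (by
      change M.tateNorm _ = 0
      rw [Rep.tateNorm, ModuleCat.comp_apply, ModuleCat.comp_apply, Iso.inv_hom_id_apply]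
      change (groupCohomology.cochainsIso₀ M).inv (M.ρ.norm x) = 0
      rw [hx, map_zero])
  obtain ⟨y, hy⟩ := h
  refine ⟨(groupHomology.chainsIso₁ N).hom y, ?_⟩
  have h1 : groupHomology.d₁₀ N ((groupHomology.chainsIso₁ N).hom y) =
      (groupHomology.chainsIso₀ N).hom ((groupHomology.inhomogeneousChains N).d 1 0 y) :=
    ConcreteCategory.congr_hom (groupHomology.comp_d₁₀_eq N) y
  have h2 := congrArg (groupHomology.chainsIso₀ N).hom hy
  refine h1.trans (h2.trans ?_)
  have h3 := ConcreteCategory.congr_hom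
    (groupHomology.chainsMap_f_0_comp_chainsIso₀ (MonoidHom.id G) f)
    ((groupHomology.chainsIso₀ M).inv x)
  rw [ModuleCat.comp_apply, ModuleCat.comp_apply, Iso.inv_hom_id_apply] at h3
  exact h3

end StableRep

/-! ### Dimension shifting for `g - 1` -/

namespace StableRep

noncomputable section

variable {k G : Type u} [Field k]

theorem module_projective_of_projective [Group G] (M : Rep.{u} k G) [h : Projective M] :
    Module.Projective (MonoidAlgebra k G) M.ρ.asModule := by
  rw [← Rep.equivalenceModuleMonoidAlgebra.map_projective_iff, ← IsProjective.iff_projective] at h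
  exact h

section Cyclic

variable [CommGroup G]

/-- The endomorphism by which a group element acts, minus the identity. -/
def actSub (g : G) (M : Rep.{u} k G) : M ⟶ M := M.applyAsHom g - 𝟙 M

theorem actSub_comm (g : G) {M N : Rep.{u} k G} (f : M ⟶ N) :
    actSub g M ≫ f = f ≫ actSub g N := by
  simp [actSub, Rep.applyAsHom_comm]

/-- Multiplication by `g - 1` on a short complex of representations. -/
def actSubShortComplex (g : G) (S : ShortComplex (Rep.{u} k G)) : S ⟶ S where
  τ₁ := actSub g _
  τ₂ := actSub g _
  τ₃ := actSub g _
  comm₁₂ := actSub_comm g _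
  comm₂₃ := actSub_comm g _

theorem shortExact_kernel {M N : Rep.{u} k G} (f : M ⟶ N) [Epi f] :
    (ShortComplex.mk (Limits.kernel.ι f) f (Limits.kernel.condition f)).ShortExact where
  exact := ShortComplex.exact_kernel f

theorem shortExact_cokernel {M N : Rep.{u} k G} (f : M ⟶ N) [Mono f] :
    (ShortComplex.mk f (Limits.cokernel.π f) (Limits.cokernel.condition f)).ShortExact where
  exact := ShortComplex.exact_cokernel f

variable [Fintype G]

instance tateCohomologyFunctor_additive (n : ℤ) :
    (tateCohomologyFunctor (R := k) (G := G) n).Additive := by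
  unfold tateCohomologyFunctor; infer_instance

open TateCohomology

/-- The connecting map commutes with `g - 1`, and is epi because the middle term vanishes in degree
`n + 1`. -/
theorem tateCohomology_map_actSub_X₁ (g : G) {S : ShortComplex (Rep.{u} k G)} (hS : S.ShortExact)
    (n : ℤ) (h2 : Limits.IsZero (tateCohomology S.X₂ (n + 1)))
    (h3 : (tateCohomologyFunctor n).map (actSub g S.X₃) = 0) :
    (tateCohomologyFunctor (n + 1)).map (actSub g S.X₁) = 0 := by
  have : Epi (δ hS n) := (exact₁ hS n).epi_f (h2.eq_of_tgt _ _)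
  rw [← cancel_epi (δ hS n)]
  have := δ_naturality hS hS (actSubShortComplex g S) n
  simpa [actSubShortComplex, h3] using this

theorem tateCohomology_map_actSub_X₃ (g : G) {S : ShortComplex (Rep.{u} k G)} (hS : S.ShortExact)
    (n : ℤ) (h2 : Limits.IsZero (tateCohomology S.X₂ n))
    (h1 : (tateCohomologyFunctor (n + 1)).map (actSub g S.X₁) = 0) :
    (tateCohomologyFunctor n).map (actSub g S.X₃) = 0 := by
  have : Mono (δ hS n) := (exact₃ hS n).mono_g (h2.eq_of_src _ _)
  rw [← cancel_mono (δ hS n)]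
  have := δ_naturality hS hS (actSubShortComplex g S) n
  simpa [actSubShortComplex, h1] using this.symm

/-- Elements of a finite abelian group act trivially on Tate cohomology. -/
theorem tateCohomology_map_actSub (g : G) (n : ℤ) (M : Rep.{u} k G) :
    (tateCohomologyFunctor n).map (actSub g M) = 0 := by
  classical
  induction n using Int.induction_on generalizing M with
  | zero =>
    refine (tateCohomology_zero_map_eq_zero_iff _).2 fun x hx => ⟨0, ?_⟩
    rw [map_zero]
    exact (sub_eq_zero.2 (hx g)).symm
  | succ n ih =>
    -- Embed `M` in a module coinduced from the trivial subgroup, acyclic in positive degrees, and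
    -- apply the induction hypothesis to the cokernel.
    let adj := Rep.resCoindAdjunction.{u} k (⊥ : Subgroup G).subtype
    have : (Rep.resFunctor.{u} (k := k) (⊥ : Subgroup G).subtype).Faithful := inferInstance
    have : Mono (adj.unit.app M) := inferInstance
    refine tateCohomology_map_actSub_X₁ g (shortExact_cokernel (adj.unit.app M)) n ?_ (ih _)
    exact ((isZero_groupCohomology_succ_of_subsingleton _ n).of_iso
      (groupCohomology.coindIso (S := (⊥ : Subgroup G))
        (Rep.res (⊥ : Subgroup G).subtype M) (n + 1))).of_iso
      ((isoGroupCohomology (n + 1)).app _)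
  | pred n ih =>
    have := module_projective_of_projective (Projective.over M)
    refine tateCohomology_map_actSub_X₃ g (shortExact_kernel (Projective.π M)) _
      (isZero_tateCohomology (Projective.over M) _) ?_
    rw [sub_add_cancel]
    exact ih _

end Cyclic
end
end StableRep

/-! ### Groups of units -/

section Units

theorem IsElementaryAbelian.pow_eq_one {q : ℕ} {G : Type u} [Group G]
    (h : IsElementaryAbelian q G) (x : G) : x ^ q = 1 := by
  obtain ⟨ι, ⟨e⟩⟩ := h
  apply Additive.ofMul.injective
  apply e.injective
  rw [ofMul_pow, map_nsmul, ofMul_one, map_zero]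
  ext i
  simp

theorem isElementaryAbelian_of_subsingleton (q : ℕ) (G : Type u) [Group G] [Subsingleton G] :
    IsElementaryAbelian q G :=
  ⟨PEmpty, ⟨{ toFun := 0, invFun := 0, left_inv := fun _ => Subsingleton.elim _ _,
              right_inv := fun _ => Subsingleton.elim _ _, map_add' := fun _ _ => by simp }⟩⟩

theorem isElementaryAbelian_of_card_eq (q : ℕ) (G : Type u) [Group G] [Fact q.Prime]
    (h : Nat.card G = q) : IsElementaryAbelian q G := by
  have : IsCyclic G := isCyclic_of_prime_card h
  have : IsAddCyclic (Additive G) := inferInstance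
  have e : ZMod (Nat.card (Additive G)) ≃+ Additive G := zmodAddCyclicAddEquiv inferInstance
  exact ⟨PUnit, ⟨(e.symm.trans (ZMod.ringEquivCongr h).toAddEquiv).trans
    (Finsupp.uniqueLinearEquiv (ZMod q) (ZMod q) PUnit.unit).symm.toAddEquiv⟩⟩

theorem le_three_of_units_pow_two {p : ℕ} [Fact p.Prime] {R : Type*} [Ring R] [Algebra (ZMod p) R]
    [Nontrivial R] (h : ∀ x : Rˣ, x ^ 2 = 1) : p ≤ 3 := by
  have h1 : ∀ x : (ZMod p)ˣ, x ^ 2 = 1 := fun x => by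
    have h2 := congrArg Units.val (h (Units.map (algebraMap (ZMod p) R).toMonoidHom x))
    ext
    apply (algebraMap (ZMod p) R).injective
    simpa using h2
  have h3 : Nat.card (ZMod p)ˣ ∣ 2 := by
    rw [← IsCyclic.exponent_eq_card]
    exact Monoid.exponent_dvd_of_forall_pow_eq_one h1
  rw [Nat.card_eq_fintype_card, ZMod.card_units] at h3
  have := Nat.le_of_dvd two_pos h3
  omega

end Units

/-! ### A nonzero stable map invisible to Tate cohomology, for `p > 3` -/

namespace StableRep

noncomputable section

section Ghost

variable (p : ℕ) [Fact p.Prime]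

/-- The two-dimensional indecomposable representation of the cyclic group of order `p`. -/
def jordanRep : Representation (ZMod p) (Multiplicative (ZMod p)) (ZMod p × ZMod p) where
  toFun g := LinearMap.prod
    (LinearMap.fst _ _ _ + g.toAdd • LinearMap.snd _ _ _) (LinearMap.snd _ _ _)
  map_one' := by ext <;> simp
  map_mul' g h := by ext <;> simp [add_comm]

theorem jordanRep_apply (g : Multiplicative (ZMod p)) (x : ZMod p × ZMod p) :
    jordanRep p g x = (x.1 + g.toAdd * x.2, x.2) := rfl

/-- The two-dimensional indecomposable representation, as an object of the category of
representations. -/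
abbrev jordanBlock : Rep.{0} (ZMod p) (Multiplicative (ZMod p)) := Rep.of (jordanRep p)

instance finite_jordanRep :
    Module.Finite (MonoidAlgebra (ZMod p) (Multiplicative (ZMod p))) (jordanRep p).asModule :=
  Module.Finite.of_restrictScalars_finite (ZMod p) _ _

/-- The summand at `g` is a polynomial of degree at most 2 in `g`, and the power sums over `𝔽_p` of
exponent below `p - 1` vanish. -/
theorem trace_jordanRep (hp : 3 < p) (φ : ZMod p × ZMod p →ₗ[ZMod p] ZMod p × ZMod p) :
    (∑ g, jordanRep p g (φ (jordanRep p g⁻¹ (0, 1)))).1 = 0 := by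
  have h : ∀ i < 3, ∑ x : ZMod p, x ^ i = 0 := fun i hi =>
    FiniteField.sum_pow_lt_card_sub_one _ i (by rw [ZMod.card]; omega)
  have h0 := h 0 (by norm_num)
  have h1 := h 1 (by norm_num)
  have h2 := h 2 (by norm_num)
  obtain ⟨⟨α, β⟩, hα⟩ : ∃ v, v = φ (1, 0) := ⟨_, rfl⟩
  obtain ⟨⟨γ, δ⟩, hγ⟩ : ∃ v, v = φ (0, 1) := ⟨_, rfl⟩
  have key : ∀ g : Multiplicative (ZMod p),
      (jordanRep p g (φ (jordanRep p g⁻¹ (0, 1)))).1 =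
        γ * g.toAdd ^ 0 + (δ - α) * g.toAdd ^ 1 - β * g.toAdd ^ 2 := fun g => by
    have : jordanRep p g⁻¹ (0, 1) = (-g.toAdd) • (1, 0) + (0, 1) := by
      rw [jordanRep_apply]; ext <;> simp
    rw [this, map_add, map_smul, ← hα, ← hγ, jordanRep_apply]
    simp
    ring
  rw [Prod.fst_sum, Finset.sum_congr rfl fun g _ => key g, Finset.sum_sub_distrib,
    Finset.sum_add_distrib, ← Finset.mul_sum, ← Finset.mul_sum, ← Finset.mul_sum]
  have e : ∀ i, ∑ g : Multiplicative (ZMod p), g.toAdd ^ i = ∑ x : ZMod p, x ^ i := fun i =>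
    Fintype.sum_equiv Multiplicative.toAdd _ _ fun _ => rfl
  rw [e, e, e, h0, h1, h2]
  simp

theorem not_faithful_stableTate (hp : 3 < p) :
    ¬ (stableTate (ZMod p) (Multiplicative (ZMod p))).Faithful := by
  intro hF
  let G := Multiplicative (ZMod p)
  let g : G := Multiplicative.ofAdd 1
  let M : FGRep (ZMod p) G := ⟨jordanBlock p, inferInstance⟩
  let f : M ⟶ M := ⟨actSub g (jordanBlock p)⟩
  have h : (Quotient.functor (stableRel (ZMod p) G)).map f =
      (Quotient.functor (stableRel (ZMod p) G)).map 0 := by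
    apply hF.map_injective
    funext n
    exact (tateCohomology_map_actSub g n (jordanBlock p)).trans
      (Functor.map_zero (tateCohomologyFunctor n) _ _).symm
  rw [Quotient.functor_map_eq_iff] at h
  obtain ⟨P, a, b, hP, hab⟩ := h
  obtain ⟨φ, hφ⟩ := exists_trace_eq_id P.obj
  -- Since the identity of `P` is the trace of `φ`, equivariance makes `b ∘ a` the trace of `b ∘ φ ∘
  -- a`.
  have h1 := trace_jordanRep p hp
    (b.hom.hom.toLinearMap ∘ₗ φ ∘ₗ a.hom.hom.toLinearMap)
  have h2 : ∑ g, jordanRep p g ((b.hom.hom.toLinearMap ∘ₗ φ ∘ₗ a.hom.hom.toLinearMap)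
      (jordanRep p g⁻¹ (0, 1))) = b.hom.hom (a.hom.hom ((0, 1) : ZMod p × ZMod p)) := by
    rw [← hφ (a.hom.hom _), map_sum]
    refine Finset.sum_congr rfl fun g _ => ?_
    rw [Rep.hom_comm_apply, ← Rep.hom_comm_apply a.hom]
    rfl
  have h3 : b.hom.hom (a.hom.hom ((0, 1) : ZMod p × ZMod p)) =
      f.hom.hom ((0, 1) : ZMod p × ZMod p) := by
    rw [sub_zero] at hab
    rw [hab]
    rfl
  have h4 : f.hom.hom ((0, 1) : ZMod p × ZMod p) =
      jordanRep p g ((0, 1) : ZMod p × ZMod p) - ((0, 1) : ZMod p × ZMod p) := rfl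
  rw [h2, h3, h4, jordanRep_apply] at h1
  simp [g] at h1

end Ghost
end
end StableRep

/-! ### Faithfulness for `p ≤ 3` -/

namespace StableRep

noncomputable section

section SmallPrimes

variable (p : ℕ) [Fact p.Prime]

/-- The element `g - 1` of the group algebra of a cyclic group of order `p`, for the standard
generator `g`. -/
def augGen : MonoidAlgebra (ZMod p) (Multiplicative (ZMod p)) :=
  MonoidAlgebra.of (ZMod p) _ (Multiplicative.ofAdd 1) - 1

theorem of_eq_augGen_add_one_pow (g : Multiplicative (ZMod p)) :
    MonoidAlgebra.of (ZMod p) _ g = (augGen p + 1) ^ g.toAdd.val := by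
  rw [augGen, sub_add_cancel, ← map_pow]
  congr 1
  apply Multiplicative.toAdd.injective
  simp

theorem augGen_pow : augGen p ^ p = 0 := by
  have : CharP (MonoidAlgebra (ZMod p) (Multiplicative (ZMod p))) p :=
    charP_of_injective_algebraMap
      (algebraMap (ZMod p) (MonoidAlgebra (ZMod p) (Multiplicative (ZMod p)))).injective p
  rw [augGen, sub_pow_char, one_pow, ← map_pow, sub_eq_zero, ← map_one (MonoidAlgebra.of _ _)]
  congr 1
  apply Multiplicative.toAdd.injective
  simp

open Polynomial in
theorem aeval_augGen_surjective :
    Function.Surjective (aeval (R := ZMod p) (augGen p)) := by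
  intro x
  induction x using MonoidAlgebra.induction_linear with
  | zero => exact ⟨0, map_zero _⟩
  | add a b ha hb =>
    obtain ⟨a, rfl⟩ := ha
    obtain ⟨b, rfl⟩ := hb
    exact ⟨a + b, map_add _ _ _⟩
  | single g r =>
    refine ⟨r • (X + 1) ^ g.toAdd.val, ?_⟩
    have h : (MonoidAlgebra.single g r : MonoidAlgebra (ZMod p) (Multiplicative (ZMod p))) =
        r • MonoidAlgebra.of (ZMod p) _ g := by simp
    rw [h, of_eq_augGen_add_one_pow]
    simp

-- In characteristic `p`, `1 + X + ⋯ + X ^ (p - 1) = (X - 1) ^ (p - 1)`; evaluate at the generator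
-- `augGen p + 1`.
open Polynomial in
theorem sum_of_eq_augGen_pow :
    ∑ g, MonoidAlgebra.of (ZMod p) (Multiplicative (ZMod p)) g = augGen p ^ (p - 1) := by
  have h : ∑ i ∈ Finset.range p, (X : (ZMod p)[X]) ^ i = (X - 1) ^ (p - 1) := by
    rw [← cyclotomic_prime, ← cyclotomic_one,
      ← cyclotomic_mul_prime_eq_pow_of_not_dvd (ZMod p) (Fact.out : p.Prime).not_dvd_one, one_mul]
  have h1 := congrArg (aeval (augGen p + 1)) h
  simp only [map_sum, map_pow, aeval_X, map_sub, map_one, add_sub_cancel_right] at h1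
  rw [← h1]
  refine Finset.sum_bij' (fun g _ => g.toAdd.val) (fun n _ => Multiplicative.ofAdd (n : ZMod p))
    (fun g _ => Finset.mem_range.2 (ZMod.val_lt _)) (fun _ _ => Finset.mem_univ _)
    (fun g _ => ?_) (fun n hn => ?_) (fun g _ => of_eq_augGen_add_one_pow p g)
  · apply Multiplicative.toAdd.injective
    simp
  · simpa using Nat.mod_eq_of_lt (Finset.mem_range.1 hn)

theorem augGen_dvd (g : Multiplicative (ZMod p)) :
    augGen p ∣ MonoidAlgebra.of (ZMod p) _ g - 1 := by
  rw [of_eq_augGen_add_one_pow]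
  simpa using sub_dvd_pow_sub_pow (augGen p + 1) 1 g.toAdd.val

variable {p}
variable {M N : Rep.{0} (ZMod p) (Multiplicative (ZMod p))}

theorem of_smul (g : Multiplicative (ZMod p)) (x : M.ρ.asModule) :
    MonoidAlgebra.of (ZMod p) _ g • x = M.ρ.asModuleEquiv.symm (M.ρ g (M.ρ.asModuleEquiv x)) :=
  (M.ρ.asModuleEquiv_symm_map_rho g _).symm

theorem rho_eq_self_of_augGen_smul (x : M.ρ.asModule) (hx : augGen p • x = 0)
    (g : Multiplicative (ZMod p)) :
    M.ρ g (M.ρ.asModuleEquiv x) = M.ρ.asModuleEquiv x := by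
  obtain ⟨c, hc⟩ := augGen_dvd p g
  have h : (MonoidAlgebra.of (ZMod p) _ g - 1) • x = 0 := by
    rw [hc, mul_comm, mul_smul, hx, smul_zero]
  rw [sub_smul, one_smul, of_smul, sub_eq_zero] at h
  exact congrArg M.ρ.asModuleEquiv h

theorem augGen_pow_smul (x : M.ρ.asModule) :
    augGen p ^ (p - 1) • x = M.ρ.asModuleEquiv.symm (M.ρ.norm (M.ρ.asModuleEquiv x)) := by
  rw [← sum_of_eq_augGen_pow, Finset.sum_smul, Representation.norm, LinearMap.sum_apply, map_sum]
  exact Finset.sum_congr rfl fun g _ => of_smul g x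

/-- Boundaries are sums of elements `(g⁻¹ - 1) x`, and `augGen p` divides each `g⁻¹ - 1`. -/
theorem exists_d₁₀_eq_augGen_smul (c : Multiplicative (ZMod p) →₀ N) :
    ∃ y : N.ρ.asModule,
      N.ρ.asModuleEquiv.symm (groupHomology.d₁₀ N c) = augGen p • y := by
  induction c using Finsupp.induction_linear with
  | zero => exact ⟨0, by simp⟩
  | add a b ha hb =>
    obtain ⟨a, ha⟩ := ha
    obtain ⟨b, hb⟩ := hb
    exact ⟨a + b, by rw [map_add, map_add, ha, hb, smul_add]⟩
  | single g x =>
    obtain ⟨c, hc⟩ := augGen_dvd p g⁻¹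
    refine ⟨c • N.ρ.asModuleEquiv.symm x, ?_⟩
    rw [← mul_smul, ← hc, sub_smul, one_smul, of_smul, groupHomology.d₁₀_single, map_sub,
      LinearEquiv.apply_symm_apply]

/-- The exponents 0 and `p` impose nothing. As `p ≤ 3`, only `e = 1` and `e = p - 1` remain, covered
by degrees 0 and -1. -/
theorem exists_smul_of_tate_map_eq_zero (hp : p ≤ 3) (f : M ⟶ N)
    (h : ∀ n, (tateCohomologyFunctor n).map f = 0) (e : ℕ) (he : e ≤ p) (x : M.ρ.asModule)
    (hx : augGen p ^ e • x = 0) : ∃ y : N.ρ.asModule,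
      Representation.IntertwiningMap.equivLinearMapAsModule _ _ f.hom x =
        augGen p ^ (p - e) • y := by
  have hp2 := (Fact.out : p.Prime).two_le
  obtain rfl | rfl | rfl | rfl : e = 0 ∨ e = p ∨ e = 1 ∨ e = p - 1 := by omega
  · rw [pow_zero, one_smul] at hx
    exact ⟨0, by rw [hx, map_zero, smul_zero]⟩
  · exact ⟨_, by rw [Nat.sub_self, pow_zero, one_smul]⟩
  · rw [pow_one] at hx
    obtain ⟨y, hy⟩ := (tateCohomology_zero_map_eq_zero_iff f).1 (h 0) (M.ρ.asModuleEquiv x)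
      (rho_eq_self_of_augGen_smul x hx)
    exact ⟨N.ρ.asModuleEquiv.symm y, by
      rw [augGen_pow_smul, LinearEquiv.apply_symm_apply, hy]; rfl⟩
  · rw [augGen_pow_smul, LinearEquiv.map_eq_zero_iff] at hx
    obtain ⟨c, hc⟩ := exists_of_tateCohomology_neg_one_map_eq_zero f (h (-1)) _ hx
    obtain ⟨y, hy⟩ := exists_d₁₀_eq_augGen_smul c
    refine ⟨y, ?_⟩
    rw [Nat.sub_sub_self (by omega), pow_one, ← hy, hc]
    rfl

theorem stableRel_zero_of_tate_map_eq_zero (hp : p ≤ 3)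
    {M N : FGRep (ZMod p) (Multiplicative (ZMod p))} (f : M ⟶ N)
    (h : ∀ n, (tateCohomologyFunctor n).map f.hom = 0) : stableRel _ _ f 0 := by
  have := M.property
  obtain ⟨ι, _, a, b, hab⟩ := exists_factorization_of_nilpotent (augGen p) p (augGen_pow p)
    (aeval_augGen_surjective p)
    (Representation.IntertwiningMap.equivLinearMapAsModule _ _ f.hom.hom)
    (exists_smul_of_tate_map_eq_zero hp f.hom h)
  let E := Representation.finsuppLEquivFreeAsModule (ZMod p) (Multiplicative (ZMod p)) ι
  let P : FGRep (ZMod p) (Multiplicative (ZMod p)) :=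
    ⟨Rep.of (Representation.free (ZMod p) (Multiplicative (ZMod p)) ι), Module.Finite.equiv E⟩
  refine ⟨P, ⟨Rep.ofHom ((Representation.IntertwiningMap.equivLinearMapAsModule _ _).symm
    (E.toLinearMap ∘ₗ a))⟩, ⟨Rep.ofHom
    ((Representation.IntertwiningMap.equivLinearMapAsModule _ _).symm
    (b ∘ₗ E.symm.toLinearMap))⟩, Module.Projective.of_equiv E, ?_⟩
  rw [sub_zero]
  ext x
  refine (LinearMap.congr_fun hab x).trans ?_
  change b (a x) = b (E.symm (E (a x)))
  rw [LinearEquiv.symm_apply_apply]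

theorem faithful_stableTate (hp : p ≤ 3) :
    (stableTate (ZMod p) (Multiplicative (ZMod p))).Faithful where
  map_injective := by
    rintro ⟨M⟩ ⟨N⟩ f g hfg
    obtain ⟨f, rfl⟩ := (Quotient.functor _).map_surjective f
    obtain ⟨g, rfl⟩ := (Quotient.functor _).map_surjective g
    rw [Quotient.functor_map_eq_iff]
    obtain ⟨P, a, b, hP, hab⟩ := stableRel_zero_of_tate_map_eq_zero hp (f - g) fun n => by
      have h : (tateCohomologyFunctor n).map f.hom = (tateCohomologyFunctor n).map g.hom :=
        congrFun hfg n
      exact ((tateCohomologyFunctor n).map_sub).trans (sub_eq_zero.2 h)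
    exact ⟨P, a, b, hP, by rw [← hab, sub_zero]⟩

end SmallPrimes

end

end StableRep

theorem corollary1p2 (p : ℕ) [Fact p.Prime] :
    List.TFAE [
      p = 2 ∨ p = 3,
      ∃ (R : Type) (_ : Ring R) (_ : Algebra (ZMod p) R),
        Nontrivial R ∧ Module.Finite (ZMod p) R ∧ IsElementaryAbelian 2 Rˣ,
      (StableRep.stableTate (ZMod p) (Multiplicative (ZMod p))).Faithful] := by
  have hp := (Fact.out : p.Prime)
  have hp2 := hp.two_le
  have hle : p ≤ 3 → p = 2 ∨ p = 3 := fun h => by omega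
  tfae_have 1 → 2 := by
    intro h
    refine ⟨ZMod p, inferInstance, inferInstance, inferInstance, inferInstance, ?_⟩
    obtain rfl | rfl := h
    · have : Subsingleton (ZMod 2)ˣ :=
        Fintype.card_le_one_iff_subsingleton.1 (by rw [ZMod.card_units])
      exact isElementaryAbelian_of_subsingleton _ _
    · apply isElementaryAbelian_of_card_eq
      rw [Nat.card_eq_fintype_card, ZMod.card_units]
  tfae_have 2 → 1 := by
    rintro ⟨R, _, _, _, _, h⟩
    exact hle (le_three_of_units_pow_two h.pow_eq_one)
  tfae_have 1 → 3 := fun h => StableRep.faithful_stableTate (by omega)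
  tfae_have 3 → 1 := fun h =>
    hle (not_lt.1 fun h3 => StableRep.not_faithful_stableTate p h3 h)
  tfae_finish
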